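/- Let $n\ge 1$ and let $H\subset\mathbb R^{n+1,1}$ be the hyperbolic space of dimension $n+1$ and constant sectional curvature $-1$, with Levi-Civita connection $\nabla$. Let $\mathcal L$ be the space of all complete oriented geodesics of $H$ (unit speed geodesics $\gamma:\mathbb R\to H$ up to orientation preserving reparametrizations), with its natural structure of a manifold of dimension $2n$. For a unit speed geodesic $\gamma$, the tangent space $T_{[\gamma]}\mathcal L$ is identified with the space $\mathcal J_\gamma$ of Jacobi fields $J$ along $\gamma$ orthogonal to $\dot\gamma$: $J$ corresponds to $\frac{d}{dt}\big|_0[\gamma_t]$, where $\gamma_t$ is a variation of $\gamma=\gamma_0$ by unit speed geodesics with variation field $J$. Let $g$ be the semi-Riemannian metric on $\mathcal L$ (of signature $(n,n)$) induced by the Killing form of the isometry group of $H$, normalized by the factor $\frac1{2n}$, so that $g(J,J)=|J|^2-|J'|^2$ for $J\in\mathcal J_\gamma$. A smooth geodesic foliation $\mathcal F$ of $H$ is given by a smooth unit vector field $V$ on $H$ all of whose integral curves are geodesics; let $\mathcal M\subset\mathcal L$ be the associated $n$-dimensional submanifold, whose points are the leaves of $\mathcal F$ (the maximal integral curves of $V$,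 as oriented geodesics). Then $|\nabla_vV|<|v|$ holds for every nonzero tangent vector $v$ of $H$ if and only if $\mathcal M$ is a space-like submanifold of $(\mathcal L,g)$, that is, $g(X,X)>0$ for every nonzero vector $X$ tangent to $\mathcal M$. -/

import Mathlib

open Set
open scoped ContDiff

namespace HypGeo

attribute [local instance] LieRing.ofAssociativeRing

noncomputable section

/-! ### The hyperbolic space (hyperboloid model) -/

/-- The vector space `ℝ^{n+2} = ℝ^{n+1} × ℝ` underlying Minkowski space. -/
abbrev Mink (n : ℕ) : Type := EuclideanSpace ℝ (Fin (n + 1)) × ℝ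

/-- The Lorentzian inner product, of signature `(n+1, 1)`. -/
def lor (n : ℕ) : LinearMap.BilinForm ℝ (Mink n) :=
  LinearMap.mk₂ ℝ (fun x y => inner ℝ x.1 y.1 - x.2 * y.2)
    (by intro x y z; simp [inner_add_left]; ring)
    (by intro c x y; simp [real_inner_smul_left]; ring)
    (by intro x y z; simp [inner_add_right]; ring)
    (by intro c x y; simp [real_inner_smul_right]; ring)

/-- The hyperbolic space `H` of dimension `n + 1` and sectional curvature `-1`: the upper sheet of
the hyperboloid `⟨x, x⟩ = -1`. -/
def Hyp (n : ℕ) : Set (Mink n) := {x | lor n x x = -1 ∧ 0 < x.2}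

/-- The tangent space `T_x H = x^⊥` for `x ∈ H`. The Riemannian metric of `H` at `x` is the
restriction of `lor n` to it. -/
def tangentAt {n : ℕ} (x : Mink n) : Submodule ℝ (Mink n) := LinearMap.ker (lor n x)

/-- The norm `|v| = √|⟨v, v⟩|` of a vector. -/
def vnorm {n : ℕ} (v : Mink n) : ℝ := Real.sqrt |lor n v v|

/-- The orthogonal projection of the ambient space onto `T_x H`, for `x ∈ H`. -/
def tangentProj {n : ℕ} (x w : Mink n) : Mink n := w + lor n x w • x

/-- The covariant derivative of `H` along a curve `c` in `H`, applied to a vector field `Y`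
along `c`: the tangential part of the ambient derivative (Gauss formula). -/
def covDerivAlong {n : ℕ} (c Y : ℝ → Mink n) (s : ℝ) : Mink n := tangentProj (c s) (deriv Y s)

/-- The covariant derivative `∇_v V` at `x ∈ H`, `v ∈ T_x H`, of a vector field `V` on `H` for the
Levi-Civita connection of `H`. Only the values of `V` on `H` matter; the derivative of `V` within
`H` in tangential directions is uniquely determined (see `covDeriv_eq_covDerivAlong`). -/
def covDeriv {n : ℕ} (V : Mink n → Mink n) (x v : Mink n) : Mink n :=
  tangentProj x (fderivWithin ℝ V (Hyp n) x v)

theorem covDeriv_eq_covDerivAlong {n : ℕ} {V : Mink n → Mink n} (hV : ContDiffOn ℝ ∞ V (Hyp n))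
    {c : ℝ → Mink n} (hc : ∀ t, c t ∈ Hyp n) {t : ℝ} {v : Mink n} (hv : HasDerivAt c v t) :
    covDeriv V (c t) v = covDerivAlong c (fun r => V (c r)) t := by
  have h := ((hV.differentiableOn (by simp)) (c t) (hc t)).hasFDerivWithinAt
  have h2 := h.comp_hasDerivAt t hv (Filter.Eventually.of_forall hc)
  unfold covDeriv covDerivAlong
  rw [← h2.deriv]
  rfl

/-! ### The space of oriented geodesics -/

/-- A complete unit speed geodesic `γ : ℝ → H`. -/
structure UnitGeodesic (n : ℕ) where
  toFun : ℝ → Mink n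
  smooth : ContDiff ℝ ∞ toFun
  mem : ∀ s, toFun s ∈ Hyp n
  unit : ∀ s, vnorm (deriv toFun s) = 1
  geodesic : ∀ s, covDerivAlong toFun (deriv toFun) s = 0

instance (n : ℕ) : CoeFun (UnitGeodesic n) (fun _ => ℝ → Mink n) := ⟨UnitGeodesic.toFun⟩

/-- Two unit speed geodesics are equivalent if they differ by an orientation preserving
reparametrization (necessarily a translation of the parameter). -/
def orientedSetoid (n : ℕ) : Setoid (UnitGeodesic n) where
  r γ σ := ∃ a : ℝ, ∀ s, σ s = γ (s + a)
  iseqv :=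
    { refl := fun γ => ⟨0, fun s => by simp⟩
      symm := by
        rintro γ σ ⟨a, h⟩
        exact ⟨-a, fun s => by rw [h]; simp⟩
      trans := by
        rintro γ σ τ ⟨a, h⟩ ⟨b, k⟩
        exact ⟨b + a, fun s => by rw [k, h, add_assoc]⟩ }

/-- The space `𝓛` of all complete oriented geodesics of `H`. -/
def GeodesicSpace (n : ℕ) : Type := Quotient (orientedSetoid n)

/-- The oriented geodesic `[γ]`. -/
def UnitGeodesic.cls {n : ℕ} (γ : UnitGeodesic n) : GeodesicSpace n :=
  Quotient.mk (orientedSetoid n) γ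

/-- The curvature tensor of `H` (constant sectional curvature `-1`). -/
def curvature {n : ℕ} (X Y Z : Mink n) : Mink n := -(lor n Y Z • X - lor n X Z • Y)

/-- `J ∈ 𝒥_γ`: `J` is a Jacobi vector field along `γ` which is orthogonal to `γ'`.
The space `𝒥_γ` is the tangent space `T_{[γ]} 𝓛`, through the canonical isomorphism that sends `J`
to the velocity `d/dt|₀ [γ_t]`, where `γ_t` is a variation of `γ = γ_0` by unit speed geodesics
with variation field `J`. -/
structure IsNormalJacobi {n : ℕ} (γ : UnitGeodesic n) (J : ℝ → Mink n) : Prop where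
  smooth : ContDiff ℝ ∞ J
  tangent : ∀ s, J s ∈ tangentAt (γ s)
  normal : ∀ s, lor n (J s) (deriv γ s) = 0
  jacobi : ∀ s, covDerivAlong γ (covDerivAlong γ J) s
    + curvature (J s) (deriv γ s) (deriv γ s) = 0

/-- `J` represents (through the identification of `T_{[γ]} 𝓛` with `𝒥_γ`) a vector tangent at `[γ]`
to `M ⊆ 𝓛`, that is, the velocity at `t = 0` of a smooth curve `t ↦ [γ_t]` in `𝓛` which is
contained in `M` and has `γ_0 = γ`. -/
def IsTangentTo {n : ℕ} (M : Set (GeodesicSpace n)) (γ : UnitGeodesic n) (J : ℝ → Mink n) : Prop :=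
  IsNormalJacobi γ J ∧ ∃ ε > 0, ∃ Γ : ℝ → UnitGeodesic n,
    ContDiffOn ℝ ∞ (fun p : ℝ × ℝ => Γ p.1 p.2) (Ioo (-ε) ε ×ˢ univ) ∧ Γ 0 = γ ∧
    (∀ t ∈ Ioo (-ε) ε, (Γ t).cls ∈ M) ∧ ∀ s, J s = deriv (fun t => Γ t s) 0

/-! ### The semi-Riemannian metric induced on `𝓛` by the Killing form -/

/-- The Lie algebra `𝔰𝔬(n+1, 1)` of the isometry group of `H`. -/
abbrev isoAlgebra (n : ℕ) : LieSubalgebra ℝ (Module.End ℝ (Mink n)) :=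
  skewAdjointLieSubalgebra (lor n)

/-- The element of `𝒥_γ = T_{[γ]} 𝓛` which is the velocity `d/dt|₀ [exp(tA) ∘ γ]` of the
infinitesimal action of `A`: the component normal to `γ'` of the Killing field `A` along `γ`. -/
def infAction {n : ℕ} (A : isoAlgebra n) (γ : UnitGeodesic n) (s : ℝ) : Mink n :=
  A.1 (γ s) - lor n (A.1 (γ s)) (deriv γ s) • deriv γ s

/-- `A` belongs to the Lie algebra of the isotropy group of `[γ]`. -/
def IsIsotropy {n : ℕ} (γ : UnitGeodesic n) (A : isoAlgebra n) : Prop :=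
  ∀ s, infAction A γ s = 0

/-- `A` is orthogonal to the isotropy algebra of `[γ]` with respect to the Killing form. -/
def IsHorizontal {n : ℕ} (γ : UnitGeodesic n) (A : isoAlgebra n) : Prop :=
  ∀ B : isoAlgebra n, IsIsotropy γ B → killingForm ℝ (isoAlgebra n) A B = 0

open Classical in
/-- The square norm `‖T_γ(J)‖ = g(T_γ(J), T_γ(J))` of the metric `g` induced on the homogeneous
space `𝓛` by the Killing form, normalized by the factor `1 / (2n)`: the tangent vector is lifted to
the orthogonal complement of the isotropy algebra. -/
def metricSq {n : ℕ} (γ : UnitGeodesic n) (J : ℝ → Mink n) : ℝ :=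
  if h : ∃ A : isoAlgebra n, IsHorizontal γ A ∧ infAction A γ = J then
    killingForm ℝ (isoAlgebra n) h.choose h.choose / (2 * n)
  else 0

/-! ### The metric is well defined

Every `J ∈ 𝒥_γ` has a lift orthogonal to the isotropy algebra, the value of the Killing form does
not depend on it, and `‖T_γ(J)‖ = |J|² - |J'|²` (`metricSq_eq`). -/

lemma trace_eq_sum_of_resolution {W ι : Type*} [AddCommGroup W] [Module ℝ W]
    [FiniteDimensional ℝ W] [Fintype ι] (φ : ι → W →ₗ[ℝ] ℝ) (v : ι → W)
    (h : ∀ w, ∑ k, φ k w • v k = w) (T : W →ₗ[ℝ] W) :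
    LinearMap.trace ℝ W T = ∑ k, φ k (T (v k)) := by
  have hT : T = ∑ k, (φ k).smulRight (T (v k)) := by
    ext w
    conv_lhs => rw [← h w]
    simp
  conv_lhs => rw [hT]
  rw [map_sum]
  simp

lemma lor_apply {n : ℕ} (x y : Mink n) : lor n x y = inner ℝ x.1 y.1 - x.2 * y.2 := rfl

lemma lor_comm {n : ℕ} (x y : Mink n) : lor n x y = lor n y x := by
  simp [lor_apply, real_inner_comm, mul_comm]

/-- A Lorentz orthonormal basis. -/
def lorBasis (n : ℕ) : Fin (n + 1) ⊕ Unit → Mink n :=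
  Sum.elim (fun i => (EuclideanSpace.single i 1, 0)) (fun _ => (0, 1))

/-- The signs of the basis vectors. -/
def lorSign (n : ℕ) : Fin (n + 1) ⊕ Unit → ℝ := Sum.elim (fun _ => 1) (fun _ => -1)

lemma lor_lorBasis (n : ℕ) (i j) : lor n (lorBasis n i) (lorBasis n j) = if i = j then lorSign n i else 0 := by
  rcases i with i | i <;> rcases j with j | j <;> simp [lor_apply, lorBasis, lorSign, EuclideanSpace.inner_single_left, PiLp.single_apply, eq_comm]

lemma lorSign_sq (n : ℕ) (i) : lorSign n i * lorSign n i = 1 := by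
  rcases i with i | i <;> simp [lorSign]

lemma resol (n : ℕ) (x : Mink n) : ∑ i, (lorSign n i * lor n x (lorBasis n i)) • lorBasis n i = x := by
  ext j
  · simp [Fintype.sum_sum_type, lorSign, lorBasis, lor_apply, EuclideanSpace.inner_single_right, Prod.fst_sum,
      Pi.single_apply]
  · simp [Fintype.sum_sum_type, lorSign, lorBasis, lor_apply, EuclideanSpace.inner_single_right, Prod.snd_sum]

lemma parseval (n : ℕ) (x y : Mink n) :
    ∑ i, lorSign n i * lor n x (lorBasis n i) * lor n y (lorBasis n i) = lor n x y := by
  conv_rhs => rw [← resol n y]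
  rw [map_sum]
  refine Finset.sum_congr rfl fun i _ => ?_
  rw [map_smul, smul_eq_mul]; ring

lemma trace_mink (n : ℕ) (C : Module.End ℝ (Mink n)) :
    LinearMap.trace ℝ _ C = ∑ i, lorSign n i * lor n (C (lorBasis n i)) (lorBasis n i) := by
  rw [trace_eq_sum_of_resolution (fun i => lorSign n i • (lor n).flip (lorBasis n i)) (lorBasis n)
    (fun w => by simpa using resol n w)]
  simp

/-- The decomposable bivector `u ∧ v`. -/
def wedgeEnd {n : ℕ} (u v : Mink n) : Module.End ℝ (Mink n) :=
  (lor n v).smulRight u - (lor n u).smulRight v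

lemma wedgeEnd_apply {n : ℕ} (u v y : Mink n) :
    wedgeEnd u v y = lor n v y • u - lor n u y • v := rfl

lemma mem_iso {n : ℕ} (A : Module.End ℝ (Mink n)) :
    A ∈ isoAlgebra n ↔ ∀ x y, lor n (A x) y = - lor n x (A y) := by
  change A ∈ (lor n).skewAdjointSubmodule ↔ _
  rw [LinearMap.mem_skewAdjointSubmodule]
  simp [LinearMap.IsSkewAdjoint, LinearMap.IsAdjointPair]

/-- The bivector `u ∧ v` as an element of `𝔰𝔬(n+1, 1)`. -/
def wedge {n : ℕ} (u v : Mink n) : isoAlgebra n :=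
  ⟨wedgeEnd u v, by
    rw [mem_iso]; intro x y
    simp [wedgeEnd_apply]
    rw [lor_comm x u, lor_comm x v]; ring⟩

lemma iso_resol {n : ℕ} (A : isoAlgebra n) :
    ∑ k : (Fin (n + 1) ⊕ Unit) × (Fin (n + 1) ⊕ Unit),
      (1 / 2 * lorSign n k.1 * lorSign n k.2 * lor n (A.1 (lorBasis n k.2)) (lorBasis n k.1)) •
        wedge (lorBasis n k.1) (lorBasis n k.2) = A := by
  have hA := (mem_iso A.1).1 A.2
  apply Subtype.ext
  apply LinearMap.ext
  intro y
  have h1 : ∑ j, ∑ i, (1 / 2 * lorSign n i * lorSign n j * lor n (A.1 (lorBasis n j)) (lorBasis n i)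
      * lor n (lorBasis n j) y) • lorBasis n i = (1 / 2 : ℝ) • A.1 y := by
    conv_rhs => rw [← resol n y]
    rw [map_sum, Finset.smul_sum]
    refine Finset.sum_congr rfl fun j _ => ?_
    rw [map_smul]
    conv_rhs => rw [← resol n (A.1 (lorBasis n j))]
    rw [Finset.smul_sum, Finset.smul_sum]
    refine Finset.sum_congr rfl fun i _ => ?_
    rw [smul_smul, smul_smul, lor_comm y]
    congr 1; ring
  have h2 : ∑ i, ∑ j, (1 / 2 * lorSign n i * lorSign n j * lor n (A.1 (lorBasis n j)) (lorBasis n i)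
      * lor n (lorBasis n i) y) • lorBasis n j = - (1 / 2 : ℝ) • A.1 y := by
    rw [neg_smul, ← h1, ← Finset.sum_neg_distrib]
    refine Finset.sum_congr rfl fun i _ => ?_
    rw [← Finset.sum_neg_distrib]
    refine Finset.sum_congr rfl fun j _ => ?_
    rw [← neg_smul, hA, lor_comm (lorBasis n j)]
    congr 1; ring
  have h3 : A.1 y = (1 / 2 : ℝ) • A.1 y - (- (1 / 2 : ℝ) • A.1 y) := by
    module
  rw [h3, ← h1, ← h2, Finset.sum_comm, ← Finset.sum_sub_distrib, Fintype.sum_prod_type,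
    AddSubmonoidClass.coe_finsetSum, LinearMap.sum_apply]
  refine Finset.sum_congr rfl fun i _ => ?_
  rw [← Finset.sum_sub_distrib, AddSubmonoidClass.coe_finsetSum, LinearMap.sum_apply]
  refine Finset.sum_congr rfl fun j _ => ?_
  change (_ : ℝ) • wedgeEnd (lorBasis n i) (lorBasis n j) y = _
  rw [wedgeEnd_apply, smul_sub, smul_smul, smul_smul]

lemma trace_mul {n : ℕ} (a b : Module.End ℝ (Mink n)) :
    LinearMap.trace ℝ _ (a * b) = ∑ i, lorSign n i * lor n (a (b (lorBasis n i))) (lorBasis n i) :=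
  trace_mink n (a * b)

lemma skew_pair_sum {n : ℕ} (a b : Module.End ℝ (Mink n))
    (ha : ∀ x y, lor n (a x) y = - lor n x (a y)) :
    ∑ i, ∑ j, lorSign n i * lorSign n j * (lor n (a (lorBasis n j)) (lorBasis n i) * lor n (b (lorBasis n j)) (lorBasis n i)) =
      - LinearMap.trace ℝ _ (a * b) := by
  rw [trace_mul, Finset.sum_comm, ← Finset.sum_neg_distrib]
  refine Finset.sum_congr rfl fun j _ => ?_
  have h := parseval n (a (lorBasis n j)) (b (lorBasis n j))
  have h2 := ha (lorBasis n j) (b (lorBasis n j))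
  rw [lor_comm (lorBasis n j)] at h2
  rw [h2] at h
  calc _ = lorSign n j * ∑ i, lorSign n i * lor n (a (lorBasis n j)) (lorBasis n i) * lor n (b (lorBasis n j)) (lorBasis n i) := by
        rw [Finset.mul_sum]; refine Finset.sum_congr rfl fun i _ => by ring
    _ = _ := by rw [h]; ring

lemma diag_sum {n : ℕ} (c : Module.End ℝ (Mink n)) :
    ∑ i, ∑ j, lorSign n i * lorSign n j * (lor n (lorBasis n j) (lorBasis n j) * lor n (c (lorBasis n i)) (lorBasis n i)) =
      (n + 2) * LinearMap.trace ℝ _ c := by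
  rw [trace_mink, Finset.mul_sum]
  refine Finset.sum_congr rfl fun i _ => ?_
  have : ∀ j, lorSign n i * lorSign n j * (lor n (lorBasis n j) (lorBasis n j) * lor n (c (lorBasis n i)) (lorBasis n i)) =
      lorSign n i * lor n (c (lorBasis n i)) (lorBasis n i) := by
    intro j
    rw [lor_lorBasis, if_pos rfl]
    linear_combination (lorSign n i * lor n (c (lorBasis n i)) (lorBasis n i)) * lorSign_sq n j
  simp only [this]
  rw [Finset.sum_const, Finset.card_univ, nsmul_eq_mul]
  simp only [Fintype.card_sum, Fintype.card_fin, Fintype.card_unit]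
  push_cast
  ring

lemma offdiag_sum {n : ℕ} (c : Module.End ℝ (Mink n)) :
    ∑ i, ∑ j, lorSign n i * lorSign n j * (lor n (lorBasis n i) (lorBasis n j) * lor n (c (lorBasis n j)) (lorBasis n i)) =
      LinearMap.trace ℝ _ c := by
  rw [trace_mink]
  refine Finset.sum_congr rfl fun i _ => ?_
  rw [Finset.sum_eq_single i]
  · rw [lor_lorBasis, if_pos rfl]
    linear_combination (lorSign n i * lor n (c (lorBasis n i)) (lorBasis n i)) * lorSign_sq n i
  · intro j _ hj
    rw [lor_lorBasis, if_neg (Ne.symm hj)]; ring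
  · simp

lemma bracket_term {n : ℕ} (a b : Module.End ℝ (Mink n))
    (ha : ∀ x y, lor n (a x) y = - lor n x (a y)) (hb : ∀ x y, lor n (b x) y = - lor n x (b y))
    (u v : Mink n) :
    lor n ((a * (b * wedgeEnd u v - wedgeEnd u v * b)
      - (b * wedgeEnd u v - wedgeEnd u v * b) * a) v) u =
        lor n v v * lor n ((a * b) u) u
        - lor n u v * lor n ((a * b) v) u
        + lor n (a v) u * lor n (b v) u
        + lor n (b v) u * lor n (a v) u
        + lor n u u * lor n ((b * a) v) v
        - lor n u v * lor n ((b * a) v) u := by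
  have hav : lor n (a v) v = 0 := by
    have := ha v v; rw [lor_comm v] at this; linarith
  have hbv : lor n (b v) v = 0 := by
    have := hb v v; rw [lor_comm v] at this; linarith
  simp only [LinearMap.sub_apply, Module.End.mul_apply, wedgeEnd_apply, map_sub, map_smul,
      LinearMap.smul_apply, smul_eq_mul]
  rw [lor_comm v (a v), lor_comm v (b v), hav, hbv, lor_comm u (a v), lor_comm u (b v),
    lor_comm v (b (a v)), lor_comm u (b (a v)), lor_comm v u]
  ring

lemma killing_eq {n : ℕ} (A B : isoAlgebra n) :
    killingForm ℝ (isoAlgebra n) A B = n * LinearMap.trace ℝ _ (A.1 * B.1) := by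
  have hA := (mem_iso A.1).1 A.2
  have hB := (mem_iso B.1).1 B.2
  rw [killingForm_apply_apply]
  let φ : (Fin (n + 1) ⊕ Unit) × (Fin (n + 1) ⊕ Unit) → isoAlgebra n →ₗ[ℝ] ℝ := fun k =>
    (1 / 2 * lorSign n k.1 * lorSign n k.2) • ((lor n).flip (lorBasis n k.1) ∘ₗ LinearMap.applyₗ (lorBasis n k.2)
      ∘ₗ (isoAlgebra n).toSubmodule.subtype)
  have hφ : ∀ k W, φ k W = 1 / 2 * lorSign n k.1 * lorSign n k.2 * lor n (W.1 (lorBasis n k.2)) (lorBasis n k.1) :=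
    fun k W => rfl
  rw [trace_eq_sum_of_resolution φ (fun k => wedge (lorBasis n k.1) (lorBasis n k.2))
    (fun W => by simp only [hφ]; exact iso_resol W)]
  obtain ⟨a, ha⟩ := A
  obtain ⟨b, hb⟩ := B
  have hterm : ∀ k, φ k ((LieAlgebra.ad ℝ (isoAlgebra n) ⟨a, ha⟩ ∘ₗ
      LieAlgebra.ad ℝ (isoAlgebra n) ⟨b, hb⟩) (wedge (lorBasis n k.1) (lorBasis n k.2))) =
      1 / 2 * (lorSign n k.1 * lorSign n k.2 * (lor n (lorBasis n k.2) (lorBasis n k.2) * lor n ((a * b) (lorBasis n k.1)) (lorBasis n k.1))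
        - lorSign n k.1 * lorSign n k.2 * (lor n (lorBasis n k.1) (lorBasis n k.2) * lor n ((a * b) (lorBasis n k.2)) (lorBasis n k.1))
        + lorSign n k.1 * lorSign n k.2 * (lor n (a (lorBasis n k.2)) (lorBasis n k.1) * lor n (b (lorBasis n k.2)) (lorBasis n k.1))
        + lorSign n k.1 * lorSign n k.2 * (lor n (b (lorBasis n k.2)) (lorBasis n k.1) * lor n (a (lorBasis n k.2)) (lorBasis n k.1))
        + lorSign n k.2 * lorSign n k.1 * (lor n (lorBasis n k.1) (lorBasis n k.1) * lor n ((b * a) (lorBasis n k.2)) (lorBasis n k.2))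
        - lorSign n k.1 * lorSign n k.2 * (lor n (lorBasis n k.1) (lorBasis n k.2) * lor n ((b * a) (lorBasis n k.2)) (lorBasis n k.1))) := by
    intro k
    have h := bracket_term a b hA hB (lorBasis n k.1) (lorBasis n k.2)
    rw [hφ]
    change 1 / 2 * lorSign n k.1 * lorSign n k.2 * lor n ((a * (b * wedgeEnd (lorBasis n k.1) (lorBasis n k.2)
      - wedgeEnd (lorBasis n k.1) (lorBasis n k.2) * b)
      - (b * wedgeEnd (lorBasis n k.1) (lorBasis n k.2) - wedgeEnd (lorBasis n k.1) (lorBasis n k.2) * b) * a)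
      (lorBasis n k.2)) (lorBasis n k.1) = _
    rw [h]; ring
  simp only [hterm]
  rw [← Finset.mul_sum, Fintype.sum_prod_type]
  simp only [Finset.sum_add_distrib, Finset.sum_sub_distrib]
  rw [diag_sum, offdiag_sum, skew_pair_sum a b hA, skew_pair_sum b a hB, offdiag_sum,
    Finset.sum_comm, diag_sum, LinearMap.trace_mul_comm ℝ b a]
  ring

lemma trace_wedge {n : ℕ} (a : Module.End ℝ (Mink n)) (ha : a ∈ isoAlgebra n) (u v : Mink n) :
    LinearMap.trace ℝ _ (a * wedgeEnd u v) = 2 * lor n (a u) v := by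
  have h : a * wedgeEnd u v = (lor n v).smulRight (a u) - (lor n u).smulRight (a v) := by
    ext y <;> simp [wedgeEnd_apply]
  rw [h, map_sub, LinearMap.trace_smulRight, LinearMap.trace_smulRight, lor_comm u,
    (mem_iso a).1 ha v u, lor_comm v]
  ring


lemma ode_solution {n : ℕ} {f : ℝ → Mink n} (hf : ContDiff ℝ ∞ f)
    (h : ∀ s, deriv (deriv f) s = f s) (s : ℝ) :
    f s = Real.cosh s • f 0 + Real.sinh s • deriv f 0 ∧
    deriv f s = Real.sinh s • f 0 + Real.cosh s • deriv f 0 := by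
  have h1 : ∀ r, HasDerivAt f (deriv f r) r := fun r =>
    ((hf.differentiable (by simp)) r).hasDerivAt
  have h2 : ∀ r, HasDerivAt (deriv f) (f r) r := fun r => by
    have hf' : ContDiff ℝ ∞ (deriv f) := (contDiff_infty_iff_deriv.1 hf).2
    have := ((hf'.differentiable (by simp)) r).hasDerivAt
    rwa [h] at this
  have e1 : ∀ r, HasDerivAt (fun r : ℝ => Real.exp (-r) • (f r + deriv f r)) 0 r := fun r => by
    have := ((hasDerivAt_neg r).exp).smul ((h1 r).add (h2 r))
    refine HasDerivAt.congr_deriv this ?_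
    simp only [Pi.add_apply, Pi.sub_apply]
    module
  have e2 : ∀ r, HasDerivAt (fun r : ℝ => Real.exp r • (f r - deriv f r)) 0 r := fun r => by
    have := (Real.hasDerivAt_exp r).smul ((h1 r).sub (h2 r))
    refine HasDerivAt.congr_deriv this ?_
    simp only [Pi.add_apply, Pi.sub_apply]
    module
  have c1 := is_const_of_deriv_eq_zero (fun r => (e1 r).differentiableAt) (fun r => (e1 r).deriv) s 0
  have c2 := is_const_of_deriv_eq_zero (fun r => (e2 r).differentiableAt) (fun r => (e2 r).deriv) s 0
  simp only [neg_zero, Real.exp_zero, one_smul] at c1 c2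
  have d1 : f s + deriv f s = Real.exp s • (f 0 + deriv f 0) := by
    rw [← c1, smul_smul, ← Real.exp_add]; simp
  have d2 : f s - deriv f s = Real.exp (-s) • (f 0 - deriv f 0) := by
    rw [← c2, smul_smul, ← Real.exp_add]; simp
  rw [Real.cosh_eq, Real.sinh_eq]
  constructor
  · have : f s = (1 / 2 : ℝ) • ((f s + deriv f s) + (f s - deriv f s)) := by module
    rw [this, d1, d2]; module
  · have : deriv f s = (1 / 2 : ℝ) • ((f s + deriv f s) - (f s - deriv f s)) := by module
    rw [this, d1, d2]; module

lemma hasDerivAt_lor {n : ℕ} {f g : ℝ → Mink n} {f' g' : Mink n} {s : ℝ} (hf : HasDerivAt f f' s)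
    (hg : HasDerivAt g g' s) :
    HasDerivAt (fun r => lor n (f r) (g r)) (lor n f' (g s) + lor n (f s) g') s := by
  have hf1 := (hasFDerivAt_fst (p := f s)).comp_hasDerivAt s hf
  have hf2 := (hasFDerivAt_snd (p := f s)).comp_hasDerivAt s hf
  have hg1 := (hasFDerivAt_fst (p := g s)).comp_hasDerivAt s hg
  have hg2 := (hasFDerivAt_snd (p := g s)).comp_hasDerivAt s hg
  have := (hf1.inner ℝ hg1).sub (hf2.mul hg2)
  refine HasDerivAt.congr_deriv this ?_
  change inner ℝ (f s).1 g'.1 + inner ℝ f'.1 (g s).1 - (f'.2 * (g s).2 + (f s).2 * g'.2) =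
    inner ℝ f'.1 (g s).1 - f'.2 * (g s).2 + (inner ℝ (f s).1 g'.1 - (f s).2 * g'.2)
  ring

lemma lor_deriv_eq {n : ℕ} {f g : ℝ → Mink n} {c : ℝ} (hf : Differentiable ℝ f)
    (hg : Differentiable ℝ g) (h : ∀ s, lor n (f s) (g s) = c) (s : ℝ) :
    lor n (deriv f s) (g s) + lor n (f s) (deriv g s) = 0 := by
  have h1 := hasDerivAt_lor (hf s).hasDerivAt (hg s).hasDerivAt
  have h2 : (fun r => lor n (f r) (g r)) = fun _ => c := funext h
  rw [h2] at h1
  exact h1.unique (hasDerivAt_const s c)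

lemma diff_deriv {n : ℕ} {f : ℝ → Mink n} (hf : ContDiff ℝ ∞ f) :
    Differentiable ℝ f ∧ Differentiable ℝ (deriv f) ∧ ContDiff ℝ ∞ (deriv f) :=
  ⟨hf.differentiable (by simp), (contDiff_infty_iff_deriv.1 hf).2.differentiable (by simp),
    (contDiff_infty_iff_deriv.1 hf).2⟩

section
variable {n : ℕ} (γ : UnitGeodesic n)

lemma geo_self (s : ℝ) : lor n (γ s) (γ s) = -1 := (γ.mem s).1

lemma geo_orth (s : ℝ) : lor n (γ s) (deriv γ s) = 0 := by
  have := lor_deriv_eq (diff_deriv γ.smooth).1 (diff_deriv γ.smooth).1 (geo_self γ) s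
  rw [lor_comm (deriv γ s)] at this; linarith

/-- Reverse Cauchy-Schwarz: vectors orthogonal to a point of `H` are space-like. -/
lemma lor_pos {x v : Mink n} (hx : lor n x x = -1) (hv : lor n x v = 0) (h0 : v ≠ 0) :
    0 < lor n v v := by
  rw [lor_apply] at *
  have h1 : 0 < ‖v.1‖ ^ 2 ∨ v.1 = 0 := by
    by_cases h : v.1 = 0
    · exact Or.inr h
    · left; positivity
  have h2 := abs_real_inner_le_norm x.1 v.1
  rw [real_inner_self_eq_norm_sq] at *
  have h3 : (inner ℝ x.1 v.1) ^ 2 ≤ ‖x.1‖ ^ 2 * ‖v.1‖ ^ 2 := by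
    rw [← mul_pow, ← sq_abs]; gcongr
  have h4 : inner ℝ x.1 v.1 = x.2 * v.2 := by linarith
  rw [h4] at h3
  rcases h1 with h1 | h1
  · have hx2 : x.2 ^ 2 = ‖x.1‖ ^ 2 + 1 := by linarith
    have : (‖x.1‖ ^ 2 + 1) * v.2 ^ 2 ≤ ‖x.1‖ ^ 2 * ‖v.1‖ ^ 2 := by
      rw [← hx2]; linarith
    nlinarith [sq_nonneg ‖x.1‖]
  · exfalso
    apply h0
    have hx2 : x.2 ^ 2 = ‖x.1‖ ^ 2 + 1 := by linarith
    rw [h1] at h3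
    have : v.2 = 0 := by
      by_contra h
      have : 0 < v.2 ^ 2 := by positivity
      have h5 : (x.2 * v.2) ^ 2 = (‖x.1‖ ^ 2 + 1) * v.2 ^ 2 := by rw [mul_pow, hx2]
      rw [h5] at h3
      simp at h3
      nlinarith [sq_nonneg ‖x.1‖]
    exact Prod.ext h1 this

lemma geo_unit (s : ℝ) : lor n (deriv γ s) (deriv γ s) = 1 := by
  have h := γ.unit s
  unfold vnorm at h
  rw [Real.sqrt_eq_one] at h
  have hne : deriv γ s ≠ 0 := by
    intro h0; rw [h0] at h; simp at h
  rw [abs_of_pos (lor_pos (geo_self γ s) (geo_orth γ s) hne)] at h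
  exact h

lemma geo_second (s : ℝ) : deriv (deriv γ) s = γ s := by
  have h := γ.geodesic s
  have h1 := lor_deriv_eq (diff_deriv γ.smooth).1 (diff_deriv γ.smooth).2.1 (geo_orth γ) s
  rw [geo_unit] at h1
  have h2 : lor n (γ s) (deriv (deriv γ) s) = -1 := by linarith
  unfold covDerivAlong tangentProj at h
  rw [h2] at h
  have := eq_neg_of_add_eq_zero_left h
  rw [this]; simp

variable {γ} {J : ℝ → Mink n}

lemma jac_cov (hJ : IsNormalJacobi γ J) : covDerivAlong γ J = deriv J := by
  funext s
  have h1 := lor_deriv_eq (diff_deriv γ.smooth).1 (diff_deriv hJ.smooth).1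
    (fun s => show lor n (γ s) (J s) = 0 from hJ.tangent s) s
  rw [lor_comm, hJ.normal] at h1
  unfold covDerivAlong tangentProj
  rw [show lor n (γ s) (deriv J s) = 0 by linarith]; simp

lemma jac_data (hJ : IsNormalJacobi γ J) (s : ℝ) :
    lor n (γ s) (J s) = 0 ∧ lor n (deriv γ s) (J s) = 0 ∧ lor n (γ s) (deriv J s) = 0 ∧
      lor n (deriv γ s) (deriv J s) = 0 := by
  have h0 : ∀ s, lor n (γ s) (J s) = 0 := fun s => hJ.tangent s
  have h0' : ∀ s, lor n (deriv γ s) (J s) = 0 := fun s => by rw [lor_comm]; exact hJ.normal s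
  have h1 := lor_deriv_eq (diff_deriv γ.smooth).1 (diff_deriv hJ.smooth).1 h0 s
  have h2 := lor_deriv_eq (diff_deriv γ.smooth).2.1 (diff_deriv hJ.smooth).1 h0' s
  rw [geo_second, h0 s] at h2
  rw [h0' s] at h1
  exact ⟨h0 s, h0' s, by linarith, by linarith⟩

lemma jac_second (hJ : IsNormalJacobi γ J) (s : ℝ) : deriv (deriv J) s = J s := by
  have h := hJ.jacobi s
  have h1 := lor_deriv_eq (diff_deriv γ.smooth).1 (diff_deriv hJ.smooth).2.1
    (fun s => (jac_data hJ s).2.2.1) s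
  rw [(jac_data hJ s).2.2.2] at h1
  rw [jac_cov hJ] at h
  unfold covDerivAlong tangentProj curvature at h
  rw [show lor n (γ s) (deriv (deriv J) s) = 0 by linarith, geo_unit, hJ.normal] at h
  simp at h
  exact (sub_eq_zero.1 (by rw [sub_eq_add_neg]; exact h))

lemma isotropy_apply {B : isoAlgebra n} (hB : IsIsotropy γ B) {w : Mink n}
    (h1 : lor n (γ 0) w = 0) (h2 : lor n (deriv γ 0) w = 0) :
    lor n (B.1 (γ 0)) w = 0 ∧ lor n (B.1 (deriv γ 0)) w = 0 := by
  have key : ∀ s, lor n (B.1 (γ s)) w = 0 := fun s => by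
    have h := hB s
    unfold infAction at h
    rw [sub_eq_zero.1 h, map_smul, LinearMap.smul_apply,
      (ode_solution γ.smooth (geo_second γ) s).2]
    simp [h1, h2]
  refine ⟨key 0, ?_⟩
  have := key 1
  rw [(ode_solution γ.smooth (geo_second γ) 1).1] at this
  simp only [map_add, map_smul, LinearMap.add_apply, LinearMap.smul_apply, key 0] at this
  have hs : Real.sinh 1 ≠ 0 := (Real.sinh_pos_iff.2 one_pos).ne'
  simpa [hs] using this

/-- The horizontal lift of the tangent vector `J` (an infinitesimal transvection). -/
def transv (γ : UnitGeodesic n) (J : ℝ → Mink n) : isoAlgebra n :=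
  wedge (γ 0) (J 0) + wedge (deriv J 0) (deriv γ 0)

lemma transv_trace (a : Module.End ℝ (Mink n)) (ha : a ∈ isoAlgebra n) :
    LinearMap.trace ℝ _ (a * (transv γ J).1) =
      2 * (lor n (a (γ 0)) (J 0) - lor n (a (deriv γ 0)) (deriv J 0)) := by
  change LinearMap.trace ℝ _ (a * (wedgeEnd _ _ + wedgeEnd _ _)) = _
  rw [mul_add, map_add, trace_wedge a ha, trace_wedge a ha, (mem_iso a).1 ha (deriv J 0),
    lor_comm (deriv J 0)]
  ring

lemma transv_apply (hJ : IsNormalJacobi γ J) :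
    (transv γ J).1 (γ 0) = J 0 ∧ (transv γ J).1 (deriv γ 0) = deriv J 0 := by
  obtain ⟨h1, h2, h3, h4⟩ := jac_data hJ 0
  constructor
  · change wedgeEnd _ _ _ + wedgeEnd _ _ _ = _
    simp [wedgeEnd_apply, lor_comm (J 0) (γ 0), lor_comm (deriv γ 0) (γ 0),
      lor_comm (deriv J 0) (γ 0), h1, h3, geo_self, geo_orth]
  · change wedgeEnd _ _ _ + wedgeEnd _ _ _ = _
    simp [wedgeEnd_apply, lor_comm (J 0) (deriv γ 0), lor_comm (deriv J 0) (deriv γ 0), h2, h4,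
      geo_unit, geo_orth]

lemma transv_horizontal (hJ : IsNormalJacobi γ J) : IsHorizontal γ (transv γ J) := by
  intro B hB
  obtain ⟨h1, h2, h3, h4⟩ := jac_data hJ 0
  rw [killing_eq, LinearMap.trace_mul_comm, transv_trace _ B.2,
    (isotropy_apply hB h1 h2).1, (isotropy_apply hB h3 h4).2]
  simp

lemma transv_infAction (hJ : IsNormalJacobi γ J) : infAction (transv γ J) γ = J := by
  funext s
  have h : (transv γ J).1 (γ s) = J s := by
    rw [(ode_solution γ.smooth (geo_second γ) s).1, map_add, map_smul, map_smul,
      (transv_apply hJ).1, (transv_apply hJ).2, ← (ode_solution hJ.smooth (jac_second hJ) s).1]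
  unfold infAction
  rw [h, hJ.normal]; simp

lemma infAction_sub (A B : isoAlgebra n) (s : ℝ) :
    infAction (A - B) γ s = infAction A γ s - infAction B γ s := by
  unfold infAction
  change (A.1 (γ s) - B.1 (γ s)) - lor n (A.1 (γ s) - B.1 (γ s)) _ • _ = _
  rw [map_sub, LinearMap.sub_apply]
  module

lemma horizontal_killing (hJ : IsNormalJacobi γ J) {A : isoAlgebra n} (hA : IsHorizontal γ A)
    (hAJ : infAction A γ = J) :
    killingForm ℝ (isoAlgebra n) A A =
      2 * n * (lor n (J 0) (J 0) - lor n (deriv J 0) (deriv J 0)) := by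
  obtain ⟨h1, h2, h3, h4⟩ := jac_data hJ 0
  have hD : IsIsotropy γ (A - transv γ J) := fun s => by
    rw [infAction_sub, hAJ, transv_infAction hJ]; simp
  have e1 := (isotropy_apply hD h1 h2).1
  have e2 := (isotropy_apply hD h3 h4).2
  change lor n (A.1 (γ 0) - (transv γ J).1 (γ 0)) _ = 0 at e1
  change lor n (A.1 (deriv γ 0) - (transv γ J).1 (deriv γ 0)) _ = 0 at e2
  rw [(transv_apply hJ).1, map_sub, LinearMap.sub_apply] at e1
  rw [(transv_apply hJ).2, map_sub, LinearMap.sub_apply] at e2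
  have hK := hA _ hD
  rw [map_sub, sub_eq_zero] at hK
  rw [hK, killing_eq, transv_trace _ A.2, sub_eq_zero.1 e1, sub_eq_zero.1 e2]
  ring

lemma jac_const (hJ : IsNormalJacobi γ J) (s : ℝ) :
    lor n (J s) (J s) - lor n (deriv J s) (deriv J s) =
      lor n (J 0) (J 0) - lor n (deriv J 0) (deriv J 0) := by
  obtain ⟨e1, e2⟩ := ode_solution hJ.smooth (jac_second hJ) s
  rw [e1, e2]
  simp only [map_add, map_smul, LinearMap.add_apply, LinearMap.smul_apply, smul_eq_mul]
  linear_combination (lor n (J 0) (J 0) - lor n (deriv J 0) (deriv J 0)) * Real.cosh_sq s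

lemma normal_zero {x v w : Mink 0} (hxx : lor 0 x x = -1) (hvv : lor 0 v v = 1)
    (hxv : lor 0 x v = 0) (hxw : lor 0 x w = 0) (hvw : lor 0 v w = 0) : lor 0 w w = 0 := by
  simp only [lor_apply, PiLp.inner_apply, Nat.reduceAdd,
    RCLike.inner_apply, conj_trivial, Finset.univ_unique, Finset.sum_singleton,
    Fin.default_eq_zero] at *
  generalize x.1.ofLp 0 = x1 at *
  generalize v.1.ofLp 0 = v1 at *
  generalize w.1.ofLp 0 = w1 at *
  generalize x.2 = x2 at *
  generalize v.2 = v2 at *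
  generalize w.2 = w2 at *
  have hd : (x1 * v2 - x2 * v1) ^ 2 = 1 := by
    linear_combination (-(v1 * v1 - v2 * v2)) * hxx + hvv + (v1 * x1 - v2 * x2) * hxv
  have k1 : (x1 * v2 - x2 * v1) * w1 = 0 := by linear_combination v2 * hxw - x2 * hvw
  have k2 : (x1 * v2 - x2 * v1) * w2 = 0 := by linear_combination v1 * hxw - x1 * hvw
  have hne : x1 * v2 - x2 * v1 ≠ 0 := by intro h; rw [h] at hd; norm_num at hd
  have := (mul_eq_zero.1 k1).resolve_left hne
  have := (mul_eq_zero.1 k2).resolve_left hne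
  simp [*]

/-- In terms of Jacobi fields, `‖T_γ(J)‖ = |J|² - |J'|²`. -/
theorem metricSq_eq (hJ : IsNormalJacobi γ J) (s : ℝ) :
    metricSq γ J = lor n (J s) (J s) - lor n (covDerivAlong γ J s) (covDerivAlong γ J s) := by
  rw [jac_cov hJ, jac_const hJ]
  have h : ∃ A : isoAlgebra n, IsHorizontal γ A ∧ infAction A γ = J :=
    ⟨_, transv_horizontal hJ, transv_infAction hJ⟩
  unfold metricSq
  rw [dif_pos h, horizontal_killing hJ h.choose_spec.1 h.choose_spec.2]
  rcases Nat.eq_zero_or_pos n with rfl | hn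
  · obtain ⟨h1, h2, h3, h4⟩ := jac_data hJ 0
    rw [normal_zero (geo_self γ 0) (geo_unit γ 0) (geo_orth γ 0) h1 h2,
      normal_zero (geo_self γ 0) (geo_unit γ 0) (geo_orth γ 0) h3 h4]
    simp
  · field_simp

end

/-! ### Space-like submanifolds and geodesic foliations -/

/-- The submanifold `M ⊆ 𝓛` is space-like: `g` is positive definite on its tangent spaces. -/
def IsSpacelike {n : ℕ} (M : Set (GeodesicSpace n)) : Prop :=
  ∀ γ : UnitGeodesic n, γ.cls ∈ M → ∀ J, IsTangentTo M γ J → J ≠ 0 → 0 < metricSq γ J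

/-- A smooth geodesic foliation of `H`: a smooth unit vector field on `H` (only its values on `H`
matter) all of whose integral curves are geodesics. -/
structure GeodesicFoliation (n : ℕ) where
  V : Mink n → Mink n
  smooth : ContDiffOn ℝ ∞ V (Hyp n)
  tangent : ∀ x ∈ Hyp n, V x ∈ tangentAt x
  unit : ∀ x ∈ Hyp n, vnorm (V x) = 1
  geodesic : ∀ (a b : ℝ) (c : ℝ → Mink n),
    (∀ t ∈ Ioo a b, c t ∈ Hyp n ∧ HasDerivAt c (V (c t)) t) →
    ∀ t ∈ Ioo a b, covDerivAlong c (deriv c) t = 0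

/-- The subset `𝓜 ⊆ 𝓛` of the leaves of the foliation. -/
def GeodesicFoliation.leaves {n : ℕ} (F : GeodesicFoliation n) : Set (GeodesicSpace n) :=
  {ℓ | ∃ γ : UnitGeodesic n, γ.cls = ℓ ∧ ∀ s, HasDerivAt γ (F.V (γ s)) s}

/-- The t.e.r. condition: `|∇_v V| < |v|` for any nonzero tangent vector `v` of `H`. -/
def GeodesicFoliation.IsTer {n : ℕ} (F : GeodesicFoliation n) : Prop :=
  ∀ x ∈ Hyp n, ∀ v ∈ tangentAt x, v ≠ 0 → vnorm (covDeriv F.V x v) < vnorm v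

end

end HypGeo

open Set
open scoped ContDiff Topology

namespace HypGeo

variable {n : ℕ}

/-! In the hyperboloid model the leaf through `x` is `s ↦ cosh s • x + sinh s • V x` (`V_hypLine`).
Move `x` along a curve in `H` with velocity `w ⟂ V x`: the leaves then vary with Jacobi field `J s =
cosh s • w + sinh s • dV w`, so `J 0 = w` and `J' 0 = dV w = ∇_w V`, the last equality because `dV
w` is already tangent to `H`. By `metricSq_eq` at `s = 0`, `g(J, J) = |w|² - |∇_w V|²`.

Each such field is tangent to the space of leaves (`isTangentTo_hypLine`), and each tangent Jacobi
field satisfies `J' 0 = dV (J 0)` (`deriv_of_isTangentTo`). Space-likeness is therefore the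
inequality `|∇_w V| < |w|` for nonzero `w ⟂ V`. The direction of `V` itself costs nothing: since
`∇_V V = 0`, adding `a • V` to `w` leaves the covariant derivative unchanged and adds `a²` to the
square norm. -/

/-! ### Explicit geodesics and curves in the hyperboloid. -/

/-- The time coordinate cannot vanish where `⟨c, c⟩ = -1`, so by the intermediate value theorem a
continuous curve cannot change sheets. -/
lemma mem_Hyp_of_continuous {c : ℝ → Mink n} (hc : Continuous c)
    (h : ∀ t, lor n (c t) (c t) = -1) (h0 : 0 < (c 0).2) (t : ℝ) : c t ∈ Hyp n := by
  refine ⟨h t, ?_⟩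
  have hne : ∀ s, (c s).2 ≠ 0 := fun s h2 => by
    have := h s
    rw [lor_apply, real_inner_self_eq_norm_sq, h2] at this
    nlinarith [sq_nonneg ‖(c s).1‖]
  by_contra! hlt
  have hcont : Continuous fun s => (c s).2 := continuous_snd.comp hc
  obtain ⟨s, hs⟩ := mem_range_of_exists_le_of_exists_ge hcont ⟨t, hlt⟩ ⟨0, h0.le⟩
  exact hne s hs

/-- The curve `s ↦ cosh s • x + sinh s • v`. -/
noncomputable def hypLine (x v : Mink n) (s : ℝ) : Mink n := Real.cosh s • x + Real.sinh s • v

@[simp] lemma hypLine_zero (x v : Mink n) : hypLine x v 0 = x := by simp [hypLine]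

/-- Group law of the geodesic flow. Exchanging the two arguments of `hypLine` gives its derivative,
so the left side restarts the curve from its position and velocity at time `a`. -/
lemma hypLine_add (x v : Mink n) (a s : ℝ) :
    hypLine (hypLine x v a) (hypLine v x a) s = hypLine x v (a + s) := by
  simp only [hypLine, Real.cosh_add, Real.sinh_add]
  module

lemma hasDerivAt_hypLine (x v : Mink n) (s : ℝ) :
    HasDerivAt (hypLine x v) (hypLine v x s) s := by
  have := ((Real.hasDerivAt_cosh s).smul_const x).add ((Real.hasDerivAt_sinh s).smul_const v)
  refine this.congr_deriv ?_
  simp only [hypLine]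
  module

lemma deriv_hypLine (x v : Mink n) : deriv (hypLine x v) = hypLine v x :=
  funext fun s => (hasDerivAt_hypLine x v s).deriv

lemma contDiff_hypLine (x v : Mink n) : ContDiff ℝ ∞ (hypLine x v) := by
  unfold hypLine
  exact (Real.contDiff_cosh.smul contDiff_const).add (Real.contDiff_sinh.smul contDiff_const)

lemma lor_hypLine (x v y w : Mink n) (s : ℝ) :
    lor n (hypLine x v s) (hypLine y w s) = Real.cosh s ^ 2 * lor n x y
      + Real.cosh s * Real.sinh s * (lor n x w + lor n v y) + Real.sinh s ^ 2 * lor n v w := by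
  simp only [hypLine, map_add, map_smul, LinearMap.add_apply, LinearMap.smul_apply, smul_eq_mul]
  ring

/-- The unit speed geodesic starting at `x ∈ H` with unit velocity `v ∈ T_x H`. -/
noncomputable def geodesicThrough (x v : Mink n) (hx : x ∈ Hyp n) (hxv : lor n x v = 0)
    (hv : lor n v v = 1) : UnitGeodesic n where
  toFun := hypLine x v
  smooth := contDiff_hypLine x v
  mem := mem_Hyp_of_continuous (contDiff_hypLine x v).continuous
    (fun s => by
      rw [lor_hypLine, hx.1, lor_comm v x, hxv, hv]
      linear_combination -Real.cosh_sq s) (by simpa using hx.2)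
  unit s := by
    have : lor n (hypLine v x s) (hypLine v x s) = 1 := by
      rw [lor_hypLine, hx.1, lor_comm v x, hxv, hv]
      linear_combination Real.cosh_sq s
    rw [deriv_hypLine, vnorm, this]
    simp
  geodesic s := by
    have : lor n (hypLine x v s) (hypLine x v s) = -1 := by
      rw [lor_hypLine, hx.1, lor_comm v x, hxv, hv]
      linear_combination -Real.cosh_sq s
    simp [covDerivAlong, tangentProj, deriv_hypLine, this]

lemma lor_nonneg_of_tangent {x w : Mink n} (hx : x ∈ Hyp n) (hw : lor n x w = 0) : 0 ≤ lor n w w := by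
  rcases eq_or_ne w 0 with rfl | h0
  · simp
  · exact (lor_pos hx.1 hw h0).le

/-- The absolute value inside `vnorm` is harmless here, because the Lorentz form is positive
definite on `T_x H`. -/
lemma vnorm_lt_vnorm_iff {x v w : Mink n} (hx : x ∈ Hyp n) (hv : lor n x v = 0)
    (hw : lor n x w = 0) : vnorm v < vnorm w ↔ lor n v v < lor n w w := by
  have h := lor_nonneg_of_tangent hx hv
  rw [vnorm, vnorm, abs_of_nonneg h, abs_of_nonneg (lor_nonneg_of_tangent hx hw)]
  exact Real.sqrt_lt_sqrt_iff h

/-- For `x ∈ H` and `w ∈ T_x H`, a curve in `H` through `x` with velocity `w`. -/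
noncomputable def curveThrough (x w : Mink n) (t : ℝ) : Mink n :=
  √(1 + t ^ 2 * lor n w w) • x + t • w

section curveThrough

variable {x w : Mink n}

lemma curveThrough_zero : curveThrough x w 0 = x := by simp [curveThrough]

lemma contDiff_curveThrough (hx : x ∈ Hyp n) (hw : lor n x w = 0) :
    ContDiff ℝ ∞ (curveThrough x w) := by
  have hq := lor_nonneg_of_tangent hx hw
  have h1 : ContDiff ℝ ∞ fun t : ℝ => √(1 + t ^ 2 * lor n w w) :=
    ContDiff.sqrt (by fun_prop) fun t => by positivity
  exact (h1.smul contDiff_const).add (contDiff_id.smul contDiff_const)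

lemma curveThrough_mem (hx : x ∈ Hyp n) (hw : lor n x w = 0) (t : ℝ) :
    curveThrough x w t ∈ Hyp n := by
  have hq := lor_nonneg_of_tangent hx hw
  refine mem_Hyp_of_continuous (contDiff_curveThrough hx hw).continuous (fun t => ?_)
    (by rw [curveThrough_zero]; exact hx.2) t
  have h : √(1 + t ^ 2 * lor n w w) ^ 2 = 1 + t ^ 2 * lor n w w := Real.sq_sqrt (by positivity)
  simp only [curveThrough, map_add, map_smul, LinearMap.add_apply, LinearMap.smul_apply,
    smul_eq_mul, lor_comm w x, hw, hx.1]
  linear_combination -h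

lemma hasDerivAt_curveThrough (x w : Mink n) : HasDerivAt (curveThrough x w) w 0 := by
  -- The normalizing factor is even in `t`, so it does not contribute to the velocity at `0`.
  have h1 : HasDerivAt (fun t : ℝ => 1 + t ^ 2 * lor n w w) 0 0 := by
    have := (((hasDerivAt_id (0 : ℝ)).pow 2).mul_const (lor n w w)).const_add 1
    simpa using this
  have h2 := ((h1.sqrt (by simp)).smul_const x).add ((hasDerivAt_id (0 : ℝ)).smul_const w)
  exact h2.congr_deriv (by simp)

end curveThrough

/-! ### Retraction onto `H`, used to extend `V` to an open set. -/

/-- The radial retraction of the solid future cone onto `H`. -/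
noncomputable def retractHyp (x : Mink n) : Mink n := (√(-lor n x x))⁻¹ • x

/-- The solid future cone. -/
def futureCone (n : ℕ) : Set (Mink n) := {x | lor n x x < 0 ∧ 0 < x.2}

lemma contDiff_lor_self : ContDiff ℝ ∞ fun x : Mink n => lor n x x := by
  simp only [lor_apply]
  exact (contDiff_fst.inner ℝ contDiff_fst).sub (contDiff_snd.mul contDiff_snd)

lemma isOpen_futureCone : IsOpen (futureCone n) :=
  (isOpen_lt contDiff_lor_self.continuous continuous_const).inter
    (isOpen_lt continuous_const continuous_snd)

lemma Hyp_subset_futureCone : Hyp n ⊆ futureCone n := fun x hx => ⟨by rw [hx.1]; simp, hx.2⟩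

lemma retractHyp_mem {x : Mink n} (hx : x ∈ futureCone n) : retractHyp x ∈ Hyp n := by
  have h0 : 0 < √(-lor n x x) := Real.sqrt_pos.2 (by linarith [hx.1])
  have h : √(-lor n x x) ^ 2 = -lor n x x := Real.sq_sqrt (by linarith [hx.1])
  refine ⟨?_, ?_⟩
  · simp only [retractHyp, map_smul, LinearMap.smul_apply, smul_eq_mul]
    field_simp
    linarith
  · exact mul_pos (inv_pos.2 h0) hx.2

lemma retractHyp_of_mem {x : Mink n} (hx : x ∈ Hyp n) : retractHyp x = x := by
  simp [retractHyp, hx.1]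

lemma contDiffOn_retractHyp : ContDiffOn ℝ ∞ (retractHyp (n := n)) (futureCone n) := by
  have h : ContDiffOn ℝ ∞ (fun x : Mink n => √(-lor n x x)) (futureCone n) :=
    contDiff_lor_self.neg.contDiffOn.sqrt fun x hx => (neg_pos.2 hx.1).ne'
  exact (h.inv fun x hx => (Real.sqrt_pos.2 (by linarith [hx.1])).ne').smul contDiffOn_id

/-! ### Derivatives of `V` and the leaves of the foliation. -/

namespace GeodesicFoliation

variable (F : GeodesicFoliation n) {x w : Mink n}

lemma lor_V (hx : x ∈ Hyp n) : lor n x (F.V x) = 0 := F.tangent x hx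

lemma lor_V_self (hx : x ∈ Hyp n) : lor n (F.V x) (F.V x) = 1 := by
  have h := F.unit x hx
  rw [vnorm, Real.sqrt_eq_one, abs_of_nonneg (lor_nonneg_of_tangent hx (F.lor_V hx))] at h
  exact h

/-- The derivative within the hypersurface `H` is not unique as a linear map, but its values on
velocities of curves in `H` are. Membership is required only near `t`, so that local integral curves
qualify. -/
lemma hasDerivAt_comp {c : ℝ → Mink n} {v : Mink n} {t : ℝ} (hc : ∀ᶠ s in 𝓝 t, c s ∈ Hyp n)
    (hv : HasDerivAt c v t) :
    HasDerivAt (fun s => F.V (c s)) (fderivWithin ℝ F.V (Hyp n) (c t) v) t :=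
  ((F.smooth.differentiableOn (by simp)) _ hc.self_of_nhds).hasFDerivWithinAt.comp_hasDerivAt t hv
    hc

/-- The ambient derivative of `V` satisfies `⟨x, dV w⟩ = -⟨w, V⟩` and `⟨V, dV w⟩ = 0`. -/
lemma lor_fderivWithin (hx : x ∈ Hyp n) (hw : lor n x w = 0) :
    lor n x (fderivWithin ℝ F.V (Hyp n) x w) = -lor n w (F.V x) ∧
      lor n (F.V x) (fderivWithin ℝ F.V (Hyp n) x w) = 0 := by
  -- Differentiate the identities `⟨x, V⟩ = 0` and `⟨V, V⟩ = 1` along a curve in `H` with velocity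
  -- `w`.
  have hc := curveThrough_mem hx hw
  have d := hasDerivAt_curveThrough x w
  have dV := F.hasDerivAt_comp (.of_forall hc) d
  have h1 := hasDerivAt_lor d dV
  have h2 := hasDerivAt_lor dV dV
  simp only [F.lor_V (hc _), F.lor_V_self (hc _), curveThrough_zero] at h1 h2
  have e1 := h1.unique (hasDerivAt_const _ _)
  have e2 := h2.unique (hasDerivAt_const _ _)
  rw [lor_comm _ (F.V x)] at e2
  exact ⟨by linarith, by linarith⟩

lemma covDeriv_eq (hx : x ∈ Hyp n) (hw : lor n x w = 0) (hwV : lor n w (F.V x) = 0) :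
    covDeriv F.V x w = fderivWithin ℝ F.V (Hyp n) x w := by
  rw [covDeriv, tangentProj, (F.lor_fderivWithin hx hw).1, hwV]
  simp

/-- Picard–Lindelöf needs a field on an open set, so `V` is extended to the future cone as `V ∘
retractHyp`. The extension is orthogonal to the position vector, hence `⟨c, c⟩` is constant along
solutions and they stay in `H`. -/
lemma exists_integralCurve (hx : x ∈ Hyp n) :
    ∃ ε > 0, ∃ c : ℝ → Mink n, c 0 = x ∧
      ∀ t ∈ Ioo (-ε) ε, c t ∈ Hyp n ∧ HasDerivAt c (F.V (c t)) t := by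
  have hW : ContDiffAt ℝ 1 (fun y => F.V (retractHyp y)) x :=
    ((F.smooth.comp contDiffOn_retractHyp fun y hy => retractHyp_mem hy).contDiffAt
      (isOpen_futureCone.mem_nhds (Hyp_subset_futureCone hx))).of_le (by norm_cast)
  obtain ⟨c, hc0, δ, hδ, hc⟩ :=
    hW.exists_forall_mem_closedBall_exists_eq_forall_mem_Ioo_hasDerivAt₀ 0
  simp only [zero_sub, zero_add] at hc
  have hU : c ⁻¹' futureCone n ∈ 𝓝 (0 : ℝ) :=
    (hc 0 ⟨by linarith, hδ⟩).continuousAt.preimage_mem_nhds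
      (isOpen_futureCone.mem_nhds (hc0 ▸ Hyp_subset_futureCone hx))
  obtain ⟨η, hη, hball⟩ := Metric.mem_nhds_iff.1 hU
  rw [Real.ball_eq_Ioo, zero_sub, zero_add] at hball
  have hsub : ∀ t ∈ Ioo (-min δ η) (min δ η), t ∈ Ioo (-δ) δ ∧ c t ∈ futureCone n := fun t ht => by
    have h1 := min_le_left δ η
    have h2 := min_le_right δ η
    exact ⟨⟨by linarith [ht.1], by linarith [ht.2]⟩,
      hball ⟨by linarith [ht.1], by linarith [ht.2]⟩⟩
  have hconst : ∀ t ∈ Ioo (-min δ η) (min δ η), lor n (c t) (c t) = -1 := by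
    have hpos : 0 < min δ η := lt_min hδ hη
    intro t ht
    have hd : ∀ s ∈ Ioo (-min δ η) (min δ η),
        HasDerivAt (fun r => lor n (c r) (c r)) 0 s := fun s hs => by
      have h := hasDerivAt_lor (hc s (hsub s hs).1) (hc s (hsub s hs).1)
      refine h.congr_deriv ?_
      have h3 := F.lor_V (retractHyp_mem (hsub s hs).2)
      have h4 : (√(-lor n (c s) (c s)))⁻¹ ≠ 0 :=
        (inv_pos.2 (Real.sqrt_pos.2 (by linarith [(hsub s hs).2.1]))).ne'
      rw [retractHyp, map_smul, LinearMap.smul_apply, smul_eq_mul, mul_eq_zero,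
        or_iff_right h4] at h3
      rw [retractHyp, lor_comm _ (c s), h3, add_zero]
    rw [isOpen_Ioo.is_const_of_deriv_eq_zero isPreconnected_Ioo
      (fun s hs => (hd s hs).differentiableAt.differentiableWithinAt)
      (fun s hs => (hd s hs).deriv) ht ⟨by linarith, hpos⟩, hc0, hx.1]
  refine ⟨min δ η, lt_min hδ hη, c, hc0, fun t ht => ?_⟩
  have hm : c t ∈ Hyp n := ⟨hconst t ht, (hsub t ht).2.2⟩
  have := hc t (hsub t ht).1
  rw [retractHyp_of_mem hm] at this
  exact ⟨hm, this⟩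

lemma eventually_V_hypLine (hx : x ∈ Hyp n) :
    ∀ᶠ t in 𝓝 (0 : ℝ), F.V (hypLine x (F.V x) t) = hypLine (F.V x) x t := by
  obtain ⟨ε, hε, c, hc0, hc⟩ := F.exists_integralCurve hx
  have hgeo := F.geodesic _ _ c hc
  have h0 : (0 : ℝ) ∈ Ioo (-ε) ε := ⟨by linarith, hε⟩
  -- The tangential part of `c''` vanishes since `c` is a geodesic, and `⟨c, c''⟩ = -⟨V, V⟩ = -1`,
  -- which leaves `c'' = c`.
  have hVc : ∀ t ∈ Ioo (-ε) ε, HasDerivAt (fun s => F.V (c s)) (c t) t := fun t ht => by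
    have hev : ∀ᶠ s in 𝓝 t, s ∈ Ioo (-ε) ε := isOpen_Ioo.mem_nhds ht
    have hd := F.hasDerivAt_comp (hev.mono fun s hs => (hc s hs).1) (hc t ht).2
    refine hd.congr_deriv ?_
    have hxV := F.lor_V (hc t ht).1
    have h1 := (F.lor_fderivWithin (hc t ht).1 hxV).1
    rw [F.lor_V_self (hc t ht).1] at h1
    have h2 := hgeo t ht
    have h3 : deriv c =ᶠ[𝓝 t] fun s => F.V (c s) := hev.mono fun s hs => (hc s hs).2.deriv
    rw [covDerivAlong, tangentProj, h3.deriv_eq, hd.deriv, h1] at h2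
    have := eq_neg_of_add_eq_zero_left h2
    rw [this]
    simp
  have hcosh := Real.hasDerivAt_cosh
  have hsinh := Real.hasDerivAt_sinh
  -- Flowing back for time `t` from the position and velocity at `t` gives a constant, by `c' = V ∘
  -- c` and `(V ∘ c)' = c`. This solves the equation on an interval, without global smoothness of
  -- `c`; `hypLine_add` then inverts the relation.
  have hP : ∀ t ∈ Ioo (-ε) ε, hypLine (c t) (F.V (c t)) (-t) = x := fun t ht => by
    have hd : ∀ s ∈ Ioo (-ε) ε,
        HasDerivAt (fun r => Real.cosh r • c r - Real.sinh r • F.V (c r)) 0 s := fun s hs => by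
      refine (((hcosh s).smul (hc s hs).2).sub ((hsinh s).smul (hVc s hs))).congr_deriv ?_
      module
    have := isOpen_Ioo.is_const_of_deriv_eq_zero isPreconnected_Ioo
      (fun s hs => (hd s hs).differentiableAt.differentiableWithinAt)
      (fun s hs => (hd s hs).deriv) ht h0
    simpa [hypLine, sub_eq_add_neg, hc0] using this
  have hQ : ∀ t ∈ Ioo (-ε) ε, hypLine (F.V (c t)) (c t) (-t) = F.V x := fun t ht => by
    have hd : ∀ s ∈ Ioo (-ε) ε,
        HasDerivAt (fun r => Real.cosh r • F.V (c r) - Real.sinh r • c r) 0 s := fun s hs => by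
      refine (((hcosh s).smul (hVc s hs)).sub ((hsinh s).smul (hc s hs).2)).congr_deriv ?_
      module
    have := isOpen_Ioo.is_const_of_deriv_eq_zero isPreconnected_Ioo
      (fun s hs => (hd s hs).differentiableAt.differentiableWithinAt)
      (fun s hs => (hd s hs).deriv) ht h0
    simpa [hypLine, sub_eq_add_neg, hc0] using this
  filter_upwards [isOpen_Ioo.mem_nhds h0] with t ht
  have e1 : hypLine x (F.V x) t = c t := by
    rw [← hQ t ht, ← hP t ht, hypLine_add (c t) (F.V (c t)) (-t) t]
    simp
  have e2 : hypLine (F.V x) x t = F.V (c t) := by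
    rw [← hQ t ht, ← hP t ht, hypLine_add (F.V (c t)) (c t) (-t) t]
    simp
  rw [e1, e2]

/-- The leaf of the foliation through a point of `H`. -/
noncomputable def leaf (hx : x ∈ Hyp n) : UnitGeodesic n :=
  geodesicThrough x (F.V x) hx (F.lor_V hx) (F.lor_V_self hx)

lemma leaf_apply (hx : x ∈ Hyp n) (s : ℝ) : F.leaf hx s = hypLine x (F.V x) s := rfl

/-- The local statement globalizes by connectedness of `ℝ`: the set of good times is closed by
continuity, open by restarting `eventually_V_hypLine` at a good time, and contains `0`. Hence the
integral curves extend to complete geodesics. -/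
lemma V_hypLine (hx : x ∈ Hyp n) (s : ℝ) :
    F.V (hypLine x (F.V x) s) = hypLine (F.V x) x s := by
  have hmem : ∀ s, hypLine x (F.V x) s ∈ Hyp n := (F.leaf hx).mem
  have hcont : Continuous fun s => F.V (hypLine x (F.V x) s) :=
    F.smooth.continuousOn.comp_continuous (contDiff_hypLine _ _).continuous hmem
  have hclosed : IsClosed {s | F.V (hypLine x (F.V x) s) = hypLine (F.V x) x s} :=
    isClosed_eq hcont (contDiff_hypLine _ _).continuous
  have hopen : IsOpen {s | F.V (hypLine x (F.V x) s) = hypLine (F.V x) x s} := by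
    rw [isOpen_iff_mem_nhds]
    intro a ha
    have h := F.eventually_V_hypLine (hmem a)
    rw [mem_ofPred_eq] at ha
    rw [ha] at h
    have ht : Filter.Tendsto (fun s : ℝ => s - a) (𝓝 a) (𝓝 0) := by
      have : Continuous fun s : ℝ => s - a := by fun_prop
      simpa using this.tendsto a
    filter_upwards [ht.eventually h] with s hs
    simpa only [hypLine_add, add_sub_cancel] using hs
  have := IsClopen.eq_univ ⟨hclosed, hopen⟩ ⟨0, by simp⟩
  exact this.ge (mem_univ s)

lemma hasDerivAt_leaf (hx : x ∈ Hyp n) (s : ℝ) :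
    HasDerivAt (F.leaf hx) (F.V (F.leaf hx s)) s := by
  rw [leaf_apply, F.V_hypLine hx]
  exact hasDerivAt_hypLine _ _ _

lemma cls_leaf_mem (hx : x ∈ Hyp n) : (F.leaf hx).cls ∈ F.leaves :=
  ⟨_, rfl, F.hasDerivAt_leaf hx⟩

/-- The integral curves of `V` are geodesics: `∇_V V = 0`. -/
lemma covDeriv_V_self (hx : x ∈ Hyp n) : covDeriv F.V x (F.V x) = 0 := by
  have h1 := covDeriv_eq_covDerivAlong F.smooth (F.leaf hx).mem (F.hasDerivAt_leaf hx 0)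
  have h2 : (fun r => F.V (F.leaf hx r)) = deriv (F.leaf hx) :=
    funext fun s => (F.hasDerivAt_leaf hx s).deriv.symm
  rw [h2, (F.leaf hx).geodesic] at h1
  simpa [leaf_apply] using h1

/-- Membership in `leaves` provides one representative that is an integral curve; every other one is
a translate of it, and `V` does not depend on time. -/
lemma hasDerivAt_of_cls_mem {γ : UnitGeodesic n} (h : γ.cls ∈ F.leaves) (s : ℝ) :
    HasDerivAt γ (F.V (γ s)) s := by
  obtain ⟨σ, hσ, hd⟩ := h
  obtain ⟨a, ha⟩ : ∃ a : ℝ, ∀ s, γ s = σ (s + a) := Quotient.exact hσ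
  rw [show γ.toFun = fun s => σ (s + a) from funext ha]
  exact (hd (s + a)).comp_add_const s a

lemma eq_hypLine_of_cls_mem {γ : UnitGeodesic n} (h : γ.cls ∈ F.leaves) (s : ℝ) :
    γ s = hypLine (γ 0) (F.V (γ 0)) s := by
  rw [hypLine, ← (F.hasDerivAt_of_cls_mem h 0).deriv]
  exact (ode_solution γ.smooth (geo_second γ) s).1

/-! ### Jacobi fields tangent to the space of leaves. -/

/-- A Jacobi field `J` tangent to the space of leaves satisfies `J' = dV (J)`. -/
lemma deriv_of_isTangentTo {γ : UnitGeodesic n} {J : ℝ → Mink n}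
    (h : IsTangentTo F.leaves γ J) :
    deriv J 0 = fderivWithin ℝ F.V (Hyp n) (γ 0) (J 0) := by
  obtain ⟨hJ, ε, hε, Γ, hΓ, rfl, hmem, hJd⟩ := h
  have hnhds : Ioo (-ε) ε ∈ 𝓝 (0 : ℝ) := isOpen_Ioo.mem_nhds ⟨by linarith, hε⟩
  have hc : HasDerivAt (fun t => Γ t 0) (J 0) 0 := by
    rw [hJd 0]
    refine DifferentiableAt.hasDerivAt ?_
    have h1 : DifferentiableAt ℝ (fun p : ℝ × ℝ => Γ p.1 p.2) ((0 : ℝ), (0 : ℝ)) :=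
      (hΓ.differentiableOn (by simp)).differentiableAt (prod_mem_nhds hnhds Filter.univ_mem)
    exact h1.comp (0 : ℝ) (f := fun t : ℝ => (t, (0 : ℝ))) (by fun_prop)
  have hV := F.hasDerivAt_comp (.of_forall fun t => (Γ t).mem 0) hc
  -- Comparing two formulas for `J 1` avoids interchanging the derivatives in `s` and `t`: one
  -- varies the explicit leaves at `s = 1`, the other solves `J'' = J`. Any time with nonzero `sinh`
  -- would do.
  have h1 : J 1 = Real.cosh 1 • J 0
      + Real.sinh 1 • fderivWithin ℝ F.V (Hyp n) (Γ 0 0) (J 0) := by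
    rw [hJd 1]
    refine HasDerivAt.deriv (((hc.const_smul _).add (hV.const_smul _)).congr_of_eventuallyEq ?_)
    filter_upwards [hnhds] with t ht
    exact F.eq_hypLine_of_cls_mem (hmem t ht) 1
  rw [(ode_solution hJ.smooth (jac_second hJ) 1).1, add_right_inj] at h1
  exact smul_right_injective _ (Real.sinh_pos_iff.2 one_pos).ne' h1

/-- The Jacobi field along the leaf through `x` with initial value `w ⟂ V x` obtained by varying
the leaf among the leaves. -/
lemma isTangentTo_hypLine (hx : x ∈ Hyp n) (hw : lor n x w = 0) (hwV : lor n w (F.V x) = 0) :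
    IsTangentTo F.leaves (F.leaf hx) (hypLine w (fderivWithin ℝ F.V (Hyp n) x w)) := by
  obtain ⟨h1, h2⟩ := F.lor_fderivWithin hx hw
  rw [hwV, neg_zero] at h1
  set D := fderivWithin ℝ F.V (Hyp n) x w
  have hwV' : lor n (F.V x) w = 0 := by rw [lor_comm, hwV]
  have hD1 : lor n D x = 0 := by rw [lor_comm, h1]
  have hD2 : lor n D (F.V x) = 0 := by rw [lor_comm, h2]
  have hγ : deriv (F.leaf hx) = hypLine (F.V x) x := deriv_hypLine _ _
  have hT : ∀ s, lor n (hypLine x (F.V x) s) (hypLine w D s) = 0 := fun s => by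
    rw [lor_hypLine, hw, h1, hwV', h2]; ring
  have hT' : ∀ s, lor n (hypLine x (F.V x) s) (hypLine D w s) = 0 := fun s => by
    rw [lor_hypLine, hw, h1, hwV', h2]; ring
  have hN : ∀ s, lor n (hypLine w D s) (hypLine (F.V x) x s) = 0 := fun s => by
    rw [lor_hypLine, lor_comm w x, hw, hwV, hD1, hD2]; ring
  -- When the ambient derivative is orthogonal to the position it is the covariant derivative. Two
  -- applications give back the field, and the curvature term is `-J`, whence the Jacobi equation.
  have hcov : ∀ y z : Mink n, (∀ s, lor n (hypLine x (F.V x) s) (hypLine z y s) = 0) →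
      covDerivAlong (F.leaf hx) (hypLine y z) = hypLine z y := fun y z h => by
    funext s
    rw [covDerivAlong, tangentProj, deriv_hypLine, leaf_apply, h s, zero_smul, add_zero]
  -- The variation is through leaves for every `t`, so the radius `1` is arbitrary.
  refine ⟨⟨contDiff_hypLine _ _, hT, fun s => by rw [hγ]; exact hN s, fun s => ?_⟩, 1, one_pos,
    fun t => F.leaf (curveThrough_mem hx hw t), ?_, ?_, fun t _ => F.cls_leaf_mem _, fun s => ?_⟩
  · rw [hcov _ _ hT', hcov _ _ hT, curvature, geo_unit, hγ, hN]
    simp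
  · have hc := (contDiff_curveThrough hx hw).comp (contDiff_fst (E := ℝ) (F := ℝ))
    have hVc : ContDiff ℝ ∞ fun p : ℝ × ℝ => F.V (curveThrough x w p.1) :=
      F.smooth.comp_contDiff hc fun p => curveThrough_mem hx hw p.1
    exact (((Real.contDiff_cosh.comp contDiff_snd).smul hc).add
      ((Real.contDiff_sinh.comp contDiff_snd).smul hVc)).contDiffOn
  · simp only [curveThrough_zero]
  · have hd := hasDerivAt_curveThrough x w
    have hV := F.hasDerivAt_comp (.of_forall (curveThrough_mem hx hw)) hd
    rw [curveThrough_zero] at hV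
    exact ((hd.const_smul (Real.cosh s)).add (hV.const_smul (Real.sinh s))).deriv.symm

/-! ### The two implications. -/

lemma isSpacelike_of_isTer (hF : F.IsTer) : IsSpacelike F.leaves := by
  intro γ hγ J hJ hJ0
  obtain ⟨d1, d2, d3, -⟩ := jac_data hJ.1 0
  have hVγ := (F.hasDerivAt_of_cls_mem hγ 0).deriv
  rw [hVγ, lor_comm] at d2
  have hD := F.deriv_of_isTangentTo hJ
  -- Since `J' 0 = dV (J 0)`, a vanishing `J 0` kills both initial data of `J`.
  have hne : J 0 ≠ 0 := fun h0 => hJ0 <| funext fun s => by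
    rw [(ode_solution hJ.1.smooth (jac_second hJ.1) s).1, hD, h0]
    simp
  have h := hF (γ 0) (γ.mem 0) (J 0) d1 hne
  rw [F.covDeriv_eq (γ.mem 0) d1 d2, ← hD, vnorm_lt_vnorm_iff (γ.mem 0) d3 d1] at h
  rw [metricSq_eq hJ.1 0, jac_cov hJ.1]
  linarith

lemma isTer_of_isSpacelike (hF : IsSpacelike F.leaves) : F.IsTer := by
  intro x hx v hv hv0
  change lor n x v = 0 at hv
  have hV := F.lor_V hx
  have hVV := F.lor_V_self hx
  -- Only the component `w` normal to the leaf gives a Jacobi field in `𝒥_γ`; the component along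
  -- `V` is handled by `∇_V V = 0`.
  obtain ⟨w, a, hw⟩ : ∃ w : Mink n, ∃ a : ℝ, v = w + a • F.V x ∧ lor n w (F.V x) = 0 :=
    ⟨v - lor n v (F.V x) • F.V x, lor n v (F.V x), by simp, by simp [hVV]⟩
  obtain ⟨rfl, hwV⟩ := hw
  have hw : lor n x w = 0 := by simpa [hV] using hv
  have hcov : covDeriv F.V x (w + a • F.V x) = fderivWithin ℝ F.V (Hyp n) x w := by
    have h0 := F.covDeriv_V_self hx
    rw [← F.covDeriv_eq hx hw hwV]
    have : covDeriv F.V x (w + a • F.V x) = covDeriv F.V x w + a • covDeriv F.V x (F.V x) := by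
      simp only [covDeriv, tangentProj, map_add, map_smul, smul_eq_mul]
      module
    rw [this, h0, smul_zero, add_zero]
  have hD := (F.lor_fderivWithin hx hw).1
  rw [hwV, neg_zero] at hD
  -- If `w = 0` the Jacobi field is zero and space-likeness says nothing, but then `∇_v V = 0` while
  -- `v ≠ 0`.
  rcases eq_or_ne w 0 with rfl | hw0
  · rw [hcov, map_zero, vnorm_lt_vnorm_iff hx (by simp) hv]
    simpa using lor_pos hx.1 hv hv0
  · rw [hcov, vnorm_lt_vnorm_iff hx hD hv]
    have hT := F.isTangentTo_hypLine hx hw hwV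
    have hm := hF _ (F.cls_leaf_mem hx) _ hT fun h => hw0 (by simpa using congrFun h 0)
    rw [metricSq_eq hT.1 0, jac_cov hT.1, deriv_hypLine, hypLine_zero, hypLine_zero] at hm
    have : lor n (w + a • F.V x) (w + a • F.V x) = lor n w w + a ^ 2 := by
      simp only [map_add, map_smul, LinearMap.add_apply, LinearMap.smul_apply, smul_eq_mul, hwV,
        lor_comm (F.V x) w, hVV]
      ring
    nlinarith [sq_nonneg a]

end GeodesicFoliation

end HypGeo

theorem mainTheorem3 (n : ℕ) (F : HypGeo.GeodesicFoliation n) :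
    F.IsTer ↔ HypGeo.IsSpacelike F.leaves :=
  ⟨F.isSpacelike_of_isTer, F.isTer_of_isSpacelike⟩
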